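/- \textbf{Setting.} For a matrix $X$, $x_j=X(:,j)$ denotes its $j$th column, $\|X(i,:)\|_1$ the $\ell_1$-norm of its $i$th row, $K(X)=\max_j\|x_j\|_2$, and $\sigma_1(X)\ge\sigma_2(X)\ge\cdots$ its singular values; $\Delta^k=\{x\in\mathbb{R}^k : x\ge 0,\ \sum_i x_i\le 1\}$. Let $f:\mathbb{R}^m\to\mathbb{R}_+$ be differentiable and strongly convex with parameter $\mu>0$, with $L$-Lipschitz gradient, and with $f(0)=0$ (so that $0$ is its global minimizer). \textbf{Recursive algorithm} (input: $M\in\mathbb{R}^{m\times n}$, a number $k$, $f$). Put $R=M$, $J=\emptyset$. While $R\ne 0$ and fewer than $k$ passes have been made: choose an index $j^*$ maximizing $f(R(:,j))$ over $j$ (in case of a tie, one of the tied indices for which $f(M(:,j))$ is largest), put $u=R(:,j^*)$, replace $R$ by $\bigl(I-\frac{uu^T}{\|u\|_2^2}\bigr)R$ and $J$ by $J\cup\{j^*\}$. Output $J$. \textbf{Outlier-handling algorithm} (input: $M\in\mathbb{R}^{m\times n}$, numbers $r,t$, $f$). (1) Compute $J$ by the recursive algorithm with $k=r+t$. (2) Compute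 $G\in\operatorname{argmin}\|M-M(:,J)X\|_F^2$ over all matrices $X$ all of whose columns lie in $\Delta^{|J|}$. (3) Output a set $J'\subseteq J$ of $r$ indices having the largest scores $\|G(j,:)\|_1$, $j\in J$. \textbf{Theorem.} Let $M'=[W,\,T,\,WH']+N\in\mathbb{R}^{m\times n}$, where $W\in\mathbb{R}^{m\times r}$ with $r\ge 2$, $T\in\mathbb{R}^{m\times t}$ (the outliers), and every column of $H'\in\mathbb{R}^{r\times(n-r-t)}$ belongs to $\Delta^r$. Put $s=r+t$ and $B=[W,T]$, and suppose that $B$ has rank $s$. Suppose that every column of $N$ satisfies $\|n_j\|_2\le\epsilon$, where \[ \epsilon<\sigma_s(B)\,\min\left(\frac{1}{2\sqrt{s-1}},\ \frac14\sqrt{\frac{\mu}{L}}\right)\left(1+80\,\frac{K(B)^2}{\sigma_s(B)^2}\,\frac{L}{\mu}\right)^{-1}, \] and put \[ \bar\epsilon=\epsilon\left(1+80\,\frac{K(B)^2}{\sigma_s(B)^2}\,\frac{L}{\mu}\right). \] If \[ \|H'(i,:)\|_1>2(2n-t-r)\,\frac{\bar\epsilon+\epsilon}{\sigma_s(B)}\qquad\text{for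 all } 1\le i\le r, \] then the outlier-handling algorithm, run on $M'$ with the numbers $r$, $t$ and the function $f$, produces an output, and for every possible output $J'$ (that is, for all choices of maximizers, minimizers and ties that the algorithm may make) there is a bijection $P:J'\to\{1,\dots,r\}$ such that \[ \max_{j\in J'}\ \|m'_{j}-w_{P(j)}\|_2\ \le\ \bar\epsilon . \] -/

import Mathlib

namespace SeparableNMF

/-- The column `X(:,j)` of a matrix as a vector of Euclidean space. -/
noncomputable def colVec {m : ℕ} {ι : Type*} (X : Matrix (Fin m) ι ℝ) (j : ι) :
    EuclideanSpace ℝ (Fin m) :=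
  WithLp.toLp 2 (fun i => X i j)

/-- `K(X) = max_j ‖x_j‖₂`, the largest Euclidean norm of a column. -/
noncomputable def maxColNorm {m : ℕ} {ι : Type*} (X : Matrix (Fin m) ι ℝ) : ℝ :=
  ⨆ j, ‖colVec X j‖

/-- `σ_k(X)` for `k ≥ 1`: the `k`-th largest singular value of a matrix.
Mathlib numbers the singular values from zero. -/
noncomputable def sigma {m : ℕ} {ι : Type*} [Fintype ι] [DecidableEq ι]
    (k : ℕ) (X : Matrix (Fin m) ι ℝ) : ℝ :=
  (Matrix.toEuclideanLin X).singularValues (k - 1)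

/-- The `ℓ₁`-norm `‖X(i,:)‖₁` of a row of a matrix. -/
def rowNormOne {κ ι : Type*} [Fintype ι] (X : Matrix κ ι ℝ) (i : κ) : ℝ :=
  ∑ j, |X i j|

/-- The squared Frobenius norm. -/
def frobeniusSq {κ ι : Type*} [Fintype κ] [Fintype ι] (X : Matrix κ ι ℝ) : ℝ :=
  ∑ i, ∑ j, X i j ^ 2

/-- The simplex `Δ = {x | x ≥ 0, ∑ xᵢ ≤ 1}`. -/
def simplex (κ : Type*) [Fintype κ] : Set (κ → ℝ) :=
  {x | (∀ i, 0 ≤ x i) ∧ ∑ i, x i ≤ 1}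

/-- `[W, W H'] = W [I, H']` is a separable matrix: `W` has full column rank, and the columns
of `H'` lie in the simplex. -/
structure IsSeparable {m r : ℕ} {κ : Type*} (W : Matrix (Fin m) (Fin r) ℝ)
    (H' : Matrix (Fin r) κ ℝ) : Prop where
  rank_eq : W.rank = r
  col_mem : ∀ j, (fun i => H' i j) ∈ simplex (Fin r)

/-- `f : ℝᵐ → ℝ₊` is strongly convex with parameter `μ > 0`, its gradient is Lipschitz continuous
with constant `L`, and its global minimum is attained at `0` with `f 0 = 0`. -/
structure IsAdmissible {m : ℕ} (f : EuclideanSpace ℝ (Fin m) → ℝ) (μ L : ℝ) : Prop where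
  mu_pos : 0 < μ
  strongConvexOn : StrongConvexOn Set.univ μ f
  differentiable : Differentiable ℝ f
  gradient_lipschitz : ∀ x y, ‖gradient f x - gradient f y‖ ≤ L * ‖x - y‖
  map_zero : f 0 = 0
  nonneg : ∀ x, 0 ≤ f x

/-- `j` is an admissible choice of `argmax_j f(R_{:j})`: it maximizes `f` among the columns of the
residual `R`, and among all such maximizers it maximizes `f` on the columns of the original
matrix `M`. -/
def IsSelected {m : ℕ} {ι : Type*} (f : EuclideanSpace ℝ (Fin m) → ℝ)
    (M R : Matrix (Fin m) ι ℝ) (j : ι) : Prop :=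
  (∀ k, f (colVec R k) ≤ f (colVec R j)) ∧
    ∀ k, f (colVec R k) = f (colVec R j) → f (colVec M k) ≤ f (colVec M j)

/-- The update `(I - u uᵀ / ‖u‖₂²) R` with `u = R_{:j}`. -/
noncomputable def deflate {m : ℕ} {ι : Type*} (R : Matrix (Fin m) ι ℝ) (j : ι) :
    Matrix (Fin m) ι ℝ :=
  (1 - (‖colVec R j‖ ^ 2)⁻¹ • Matrix.vecMulVec (fun i => R i j) (fun i => R i j)) * R

/-- `Reaches f M c R J`: after `c` passes through the loop of the recursive algorithm started
at `M`, the residual can be `R` and the set of extracted indices can be `J`. -/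
inductive Reaches {m : ℕ} {ι : Type*} [DecidableEq ι] (f : EuclideanSpace ℝ (Fin m) → ℝ)
    (M : Matrix (Fin m) ι ℝ) : ℕ → Matrix (Fin m) ι ℝ → Finset ι → Prop
  | init : Reaches f M 0 M ∅
  | step {c : ℕ} {R : Matrix (Fin m) ι ℝ} {J : Finset ι} {j : ι} :
      Reaches f M c R J → R ≠ 0 → IsSelected f M R j →
        Reaches f M (c + 1) (deflate R j) (insert j J)

/-- `J` is an output of the recursive algorithm on input `M`, with `k` columns to be extracted:
the loop runs as long as the residual is nonzero and fewer than `k` passes have been made. -/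
def IsRecursiveOutput {m : ℕ} {ι : Type*} [DecidableEq ι] (f : EuclideanSpace ℝ (Fin m) → ℝ)
    (M : Matrix (Fin m) ι ℝ) (k : ℕ) (J : Finset ι) : Prop :=
  ∃ (c : ℕ) (R : Matrix (Fin m) ι ℝ), Reaches f M c R J ∧ c ≤ k ∧ (R = 0 ∨ c = k)

/-- `G ∈ argmin ‖M - M(:,J) X‖_F²` over the matrices `X` all of whose columns lie in the
simplex. -/
def IsAbundance {m : ℕ} {ι : Type*} [Fintype ι] (M : Matrix (Fin m) ι ℝ) (J : Finset ι)
    (G : Matrix {i // i ∈ J} ι ℝ) : Prop :=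
  (∀ k, (fun i => G i k) ∈ simplex {i // i ∈ J}) ∧
    ∀ X : Matrix {i // i ∈ J} ι ℝ, (∀ k, (fun i => X i k) ∈ simplex {i // i ∈ J}) →
      frobeniusSq (M - M.submatrix id Subtype.val * G) ≤
        frobeniusSq (M - M.submatrix id Subtype.val * X)

/-- `J'` consists of `r` indices of `J` having the largest scores `‖G(j,:)‖₁`. -/
def IsTopRows {ι : Type*} [Fintype ι] (r : ℕ) (J : Finset ι) (G : Matrix {i // i ∈ J} ι ℝ)
    (J' : Finset ι) : Prop :=
  J' ⊆ J ∧ J'.card = r ∧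
    ∀ a b : {i // i ∈ J}, a.1 ∈ J' → b.1 ∉ J' → rowNormOne G b ≤ rowNormOne G a

/-- `J'` is an output of the outlier-handling algorithm on input `M`, with `r` columns to be
returned in the presence of `t` outliers. -/
def IsOutlierOutput {m : ℕ} {ι : Type*} [Fintype ι] [DecidableEq ι]
    (f : EuclideanSpace ℝ (Fin m) → ℝ) (M : Matrix (Fin m) ι ℝ) (r t : ℕ)
    (J' : Finset ι) : Prop :=
  ∃ (J : Finset ι) (G : Matrix {i // i ∈ J} ι ℝ),
    IsRecursiveOutput f M (r + t) J ∧ IsAbundance M J G ∧ IsTopRows r J G J'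

end SeparableNMF

/-!
Let `b i` be the columns of `B = [W, T]`, let `σ` and `K` be the smallest singular value of `B` and
the largest norm of a column, and put `ω = σ / 2`. The columns of `M'` are combinations of the `b i`
with weights in the simplex, up to noise of size `ε`.

*Robustness of the recursive algorithm.* The residual after some passes is the image of `M'` under a
linear contraction `Q` that kills the extracted columns and moves every vector by a combination of
them (`IsResidual`). Replacing the extracted `b i` by their approximations perturbs `B` by at most
`√(s - 1) δ ≤ σ / 2`, with `δ = εbar`, so the vectors `Q (b i)` that belong to the remaining columns
have norm at least `ω` and mutual distance at least `√2 ω` (`IsResidual.le_norm_map_sum`), while `Q`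
maps the extracted `b i` to vectors of norm at most `δ`, where `f` is small. Let `∑ i, h i • Q (b i)`
be the noiseless version of the column on which `f` is largest. The value of `f` there is within
about `2 ε K L` of the maximum, while by strong convexity it lies below the mean of the values
`f (Q (b i))` by at least `μ / 2` times the variance of the weights `h`
(`StrongConvexOn.map_sum_le_sub_variance`). So the weight of the extracted columns and the variance
are both small, and as the remaining vectors are separated, one `h l` is within
`10 ε K L / (μ ω²)` of `1` (`IsAdmissible.exists_large_weight`). This makes the selected column of
`M'` approximate `b l` up to `δ`, and `l` is new. After `s` passes the extracted columns are in
bijection with the columns of `B`.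

*Scores.* The Frobenius problem decouples over the columns. An optimal column of `G` reproduces its
column of `M'` exactly if that one was extracted, and up to `ε + δ` otherwise, since the true weights
do so. Because `B` expands norms by at least `σ`, the entries of `G` are within `(δ + ε) / σ`,
respectively `2 (δ + ε) / σ`, of the true weights, and every score is within
`(2 n - s) (δ + ε) / σ` of the total weight of its column
(`NoisyFactorization.abs_rowNormOne_sub_le`). The total weight is `1` for an outlier and
`1 + ‖H'(i,:)‖₁` for a column of `W`, so the hypothesis on `H'` separates the scores.
-/

namespace SeparableNMF

/-! ### Admissible functions -/

section Admissible

variable {m : ℕ} {f : EuclideanSpace ℝ (Fin m) → ℝ} {μ L : ℝ}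

lemma IsAdmissible.gradient_zero (hf : IsAdmissible f μ L) : gradient f 0 = 0 := by
  have h : IsLocalMin f 0 := Filter.Eventually.of_forall fun x => by
    rw [hf.map_zero]; exact hf.nonneg x
  simp [gradient, h.fderiv_eq_zero]

lemma IsAdmissible.abs_sub_le (hf : IsAdmissible f μ L) (hL : 0 ≤ L) {ρ : ℝ}
    {x y : EuclideanSpace ℝ (Fin m)} (hx : ‖x‖ ≤ ρ) (hy : ‖y‖ ≤ ρ) :
    |f y - f x| ≤ L * ρ * ‖y - x‖ := by
  have hbound : ∀ z ∈ Metric.closedBall (0 : EuclideanSpace ℝ (Fin m)) ρ,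
      ‖fderiv ℝ f z‖ ≤ L * ρ := by
    intro z hz
    have h1 := hf.gradient_lipschitz z 0
    rw [hf.gradient_zero, sub_zero, sub_zero] at h1
    rw [← toDual_gradient, LinearIsometryEquiv.norm_map]
    exact h1.trans (mul_le_mul_of_nonneg_left (by simpa using hz) hL)
  exact (convex_closedBall _ _).norm_image_sub_le_of_norm_fderiv_le
    (fun z _ => hf.differentiable z) hbound (by simpa using hx) (by simpa using hy)

lemma IsAdmissible.le_mul_norm_sq (hf : IsAdmissible f μ L) (hL : 0 ≤ L)
    (x : EuclideanSpace ℝ (Fin m)) : f x ≤ L * ‖x‖ ^ 2 := by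
  have h := hf.abs_sub_le hL (x := 0) (y := x) (ρ := ‖x‖) (by simp) le_rfl
  rw [hf.map_zero, sub_zero, sub_zero] at h
  nlinarith [le_abs_self (f x)]

lemma IsAdmissible.mul_norm_sq_le (hf : IsAdmissible f μ L) (x : EuclideanSpace ℝ (Fin m)) :
    μ / 2 * ‖x‖ ^ 2 ≤ f x := by
  by_contra! hlt
  set c := μ / 2 * ‖x‖ ^ 2 with hc
  have h0 := hf.nonneg x
  have hcpos : 0 < c := by linarith
  -- the point `t • x` with this `t > 0` would have a negative value
  set t := (c - f x) / (2 * c) with ht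
  have htc : t * c = (c - f x) / 2 := by rw [ht]; field_simp
  have ht0 : 0 < t := by rw [ht]; apply div_pos <;> linarith
  have ht1 : t ≤ 1 := by rw [ht, div_le_one (by linarith)]; linarith
  have h := hf.strongConvexOn.2 (Set.mem_univ 0) (Set.mem_univ x) (sub_nonneg.2 ht1) ht0.le
    (by ring)
  simp only [smul_zero, zero_add, hf.map_zero, zero_sub, norm_neg, smul_eq_mul, mul_zero] at h
  rw [← hc] at h
  have h2 := hf.nonneg (t • x)
  have h3 : 0 ≤ t * (f x - (1 - t) * c) := by linarith
  have h4 := nonneg_of_mul_nonneg_right h3 ht0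
  nlinarith

lemma IsAdmissible.lipschitz_pos (hf : IsAdmissible f μ L) {x : EuclideanSpace ℝ (Fin m)}
    (hx : x ≠ 0) : 0 < L ∧ μ ≤ 2 * L := by
  have hx' : 0 < ‖x‖ := norm_pos_iff.2 hx
  have h1 := hf.gradient_lipschitz x 0
  rw [sub_zero x] at h1
  have hL : 0 ≤ L := nonneg_of_mul_nonneg_left ((norm_nonneg _).trans h1) hx'
  have h2 := (hf.mul_norm_sq_le x).trans (hf.le_mul_norm_sq hL x)
  have h3 := le_of_mul_le_mul_right h2 (by positivity)
  have := hf.mu_pos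
  constructor <;> linarith

end Admissible

/-! ### Weights in the simplex -/

section Weights

variable {κ : Type*} [Fintype κ]

lemma norm_sum_smul_le_of_mem_simplex {E : Type*} [NormedAddCommGroup E] [NormedSpace ℝ E]
    {h : κ → ℝ} (hh : h ∈ simplex κ) {a : κ → E} {K : ℝ} (hK : 0 ≤ K) (ha : ∀ i, ‖a i‖ ≤ K) :
    ‖∑ i, h i • a i‖ ≤ K := by
  calc ‖∑ i, h i • a i‖ ≤ ∑ i, h i * K := norm_sum_le_of_le _ fun i _ => by
        rw [norm_smul, Real.norm_of_nonneg (hh.1 i)]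
        exact mul_le_mul_of_nonneg_left (ha i) (hh.1 i)
    _ = (∑ i, h i) * K := (Finset.sum_mul ..).symm
    _ ≤ K := mul_le_of_le_one_left hK hh.2

/-- Jensen's inequality for a strongly convex function: the gain is `μ / 2` times the variance
of the random vector that takes the value `a i` with probability `h i`, and `0` with the
remaining probability. -/
lemma StrongConvexOn.map_sum_le_sub_variance {E : Type*} [NormedAddCommGroup E]
    [InnerProductSpace ℝ E] {f : E → ℝ} {μ : ℝ} (hf : StrongConvexOn Set.univ μ f)
    (h0 : f 0 = 0) {h : κ → ℝ} (hh : h ∈ simplex κ) (a : κ → E) :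
    f (∑ i, h i • a i) ≤ ∑ i, h i * f (a i) -
      μ / 2 * (∑ i, h i * ‖a i‖ ^ 2 - ‖∑ i, h i • a i‖ ^ 2) := by
  have hg := strongConvexOn_iff_convex.1 hf
  have hJ := hg.map_sum_le (t := Finset.univ) (w := fun o : Option κ => o.elim (1 - ∑ i, h i) h)
    (p := fun o : Option κ => o.elim 0 a)
    (by rintro (_ | i) -
        · simpa using hh.2
        · exact hh.1 i)
    (by simp [Fintype.sum_option]) (fun _ _ => Set.mem_univ _)
  simp only [Fintype.sum_option, Option.elim, smul_zero, zero_add, h0, norm_zero, smul_eq_mul] at hJ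
  simp only [mul_sub, Finset.sum_sub_distrib] at hJ
  have e : ∑ i, h i * (μ / 2 * ‖a i‖ ^ 2) = μ / 2 * ∑ i, h i * ‖a i‖ ^ 2 := by
    rw [Finset.mul_sum]; exact Finset.sum_congr rfl fun i _ => by ring
  rw [e] at hJ
  rw [mul_sub]
  norm_num at hJ
  linarith

lemma sum_sum_mul_norm_sub_sq {E : Type*} [NormedAddCommGroup E] [InnerProductSpace ℝ E]
    (h : κ → ℝ) (a : κ → E) :
    ∑ i, ∑ j, h i * h j * ‖a i - a j‖ ^ 2 =
      2 * ((∑ i, h i) * ∑ i, h i * ‖a i‖ ^ 2 - ‖∑ i, h i • a i‖ ^ 2) := by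
  have e1 : ‖∑ i, h i • a i‖ ^ 2 = ∑ i, ∑ j, h i * h j * inner ℝ (a i) (a j) := by
    rw [← real_inner_self_eq_norm_sq, sum_inner]
    refine Finset.sum_congr rfl fun i _ => ?_
    rw [inner_sum]
    refine Finset.sum_congr rfl fun j _ => ?_
    rw [real_inner_smul_left, real_inner_smul_right]; ring
  have e2 : (∑ i, h i) * ∑ i, h i * ‖a i‖ ^ 2 = ∑ i, ∑ j, h i * (h j * ‖a j‖ ^ 2) :=
    Finset.sum_mul_sum ..
  have e3 : (∑ i, h i) * ∑ i, h i * ‖a i‖ ^ 2 = ∑ i, ∑ j, h j * (h i * ‖a i‖ ^ 2) := by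
    rw [e2, Finset.sum_comm]
  have e4 : ∀ i j, h i * h j * ‖a i - a j‖ ^ 2 =
      h j * (h i * ‖a i‖ ^ 2) + h i * (h j * ‖a j‖ ^ 2) - 2 * (h i * h j * inner ℝ (a i) (a j)) := by
    intro i j; rw [norm_sub_sq_real]; ring
  have e5 : ∑ i, ∑ j, 2 * (h i * h j * inner ℝ (a i) (a j)) =
      2 * ∑ i, ∑ j, h i * h j * inner ℝ (a i) (a j) := by simp only [Finset.mul_sum]
  simp only [e4, Finset.sum_sub_distrib, Finset.sum_add_distrib]
  rw [← e2, ← e3, e5, e1]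
  ring

/-- A weight `h` that is spread over points of `U` at pairwise distance at least `√2 ω` has a
large variance. -/
lemma le_variance_of_separated {E : Type*} [NormedAddCommGroup E] [InnerProductSpace ℝ E]
    {h : κ → ℝ} (hh : h ∈ simplex κ) (a : κ → E) {U : Finset κ} {ω p : ℝ}
    (hsep : ∀ i ∈ U, ∀ j ∈ U, i ≠ j → 2 * ω ^ 2 ≤ ‖a i - a j‖ ^ 2) (hp : ∀ i ∈ U, h i ≤ p) :
    ω ^ 2 * ((∑ i ∈ U, h i) * (∑ i ∈ U, h i - p)) ≤
      ∑ i, h i * ‖a i‖ ^ 2 - ‖∑ i, h i • a i‖ ^ 2 := by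
  classical
  have hpos := hh.1
  have h1 : ∑ i ∈ U, ∑ j ∈ U, 2 * ω ^ 2 * (h i * h j - if i = j then h i * p else 0) ≤
      ∑ i, ∑ j, h i * h j * ‖a i - a j‖ ^ 2 := by
    refine (Finset.sum_le_sum fun i hi => Finset.sum_le_sum fun j hj => ?_).trans
      ((Finset.sum_le_sum fun i _ => Finset.sum_le_univ_sum_of_nonneg fun j => ?_).trans
      (Finset.sum_le_univ_sum_of_nonneg fun i => Finset.sum_nonneg fun j _ => ?_))
    · by_cases hij : i = j
      · subst hij
        have := mul_le_mul_of_nonneg_left (hp i hi) (hpos i)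
        simp only [if_true, sub_self, norm_zero]
        nlinarith [sq_nonneg ω]
      · rw [if_neg hij, sub_zero]
        nlinarith [hsep i hi j hj hij, mul_nonneg (hpos i) (hpos j)]
    · have := hpos i; have := hpos j; positivity
    · have := hpos i; have := hpos j; positivity
  have h2 : ∑ i ∈ U, ∑ j ∈ U, 2 * ω ^ 2 * (h i * h j - if i = j then h i * p else 0) =
      2 * ω ^ 2 * ((∑ i ∈ U, h i) * (∑ i ∈ U, h i - p)) := by
    simp only [← Finset.mul_sum, Finset.sum_sub_distrib, Finset.sum_ite_eq]
    congr 1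
    rw [mul_sub, Finset.sum_mul_sum, Finset.sum_mul]
    simp only [Finset.mul_sum]
    congr 1
    exact Finset.sum_congr rfl fun i hi => if_pos hi
  rw [h2, sum_sum_mul_norm_sub_sq] at h1
  have h3 : (∑ i, h i) * ∑ i, h i * ‖a i‖ ^ 2 ≤ ∑ i, h i * ‖a i‖ ^ 2 :=
    mul_le_of_le_one_left (Finset.sum_nonneg fun i _ => by have := hpos i; positivity) hh.2
  linarith

/-- If `f` almost attains at `x ≈ ∑ i, h i • a i` its largest value over the points `a i`, then
one of the weights is almost `1`. The points indexed by `U` are the ones that are separated from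
each other and from `0`; at the others `f` is small. -/
lemma IsAdmissible.exists_large_weight {m : ℕ} {f : EuclideanSpace ℝ (Fin m) → ℝ} {μ L : ℝ}
    (hf : IsAdmissible f μ L) (hL : 0 ≤ L) {h : κ → ℝ} (hh : h ∈ simplex κ)
    {a : κ → EuclideanSpace ℝ (Fin m)} {U : Finset κ} (hU : U.Nonempty) {K ω ε : ℝ}
    (hε : 0 ≤ ε) (hω : 0 < ω) (hεK : 82 * ε ≤ K)
    (hη : 40 * (ε * K * L) ≤ μ * ω ^ 2)
    (ha : ∀ i, ‖a i‖ ≤ K) (haU : ∀ i ∈ U, ω ≤ ‖a i‖)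
    (hsep : ∀ i ∈ U, ∀ j ∈ U, i ≠ j → 2 * ω ^ 2 ≤ ‖a i - a j‖ ^ 2)
    (hsmall : ∀ i ∉ U, f (a i) ≤ μ * ω ^ 2 / 4)
    {x : EuclideanSpace ℝ (Fin m)} (hx : ‖x - ∑ i, h i • a i‖ ≤ ε)
    (hmax : ∀ i ∈ U, ∃ y, ‖y - a i‖ ≤ ε ∧ f y ≤ f x) :
    ∃ l ∈ U, μ * ω ^ 2 * (1 - h l) ≤ 10 * (ε * K * L) := by
  classical
  have hK : 0 ≤ K := by linarith
  obtain ⟨v, hvU, hv⟩ := U.exists_max_image (fun i => f (a i)) hU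
  obtain ⟨l, hlU, hl⟩ := U.exists_max_image h hU
  refine ⟨l, hlU, ?_⟩
  have hz := norm_sum_smul_le_of_mem_simplex hh hK ha
  set z := ∑ i, h i • a i with hzdef
  have hμ := hf.mu_pos
  obtain ⟨y, hya, hyx⟩ := hmax v hvU
  have hnear : ∀ u w : EuclideanSpace ℝ (Fin m), ‖w‖ ≤ K → ‖u - w‖ ≤ ε →
      |f u - f w| ≤ 83 / 82 * (ε * K * L) := by
    intro u w hw huw
    have hu : ‖u‖ ≤ K + ε := by
      calc ‖u‖ = ‖w + (u - w)‖ := by congr 1; abel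
        _ ≤ _ := (norm_add_le _ _).trans (add_le_add hw huw)
    refine (hf.abs_sub_le hL (ρ := K + ε) (by linarith) hu).trans ?_
    calc L * (K + ε) * ‖u - w‖ ≤ L * (83 / 82 * K) * ε := by gcongr; linarith
      _ = _ := by ring
  have hy' := abs_le.1 (hnear y (a v) (ha v) hya)
  have hx' := abs_le.1 (hnear x z hz hx)
  have hfv : μ * ω ^ 2 / 2 ≤ f (a v) := by
    refine le_trans ?_ (hf.mul_norm_sq_le (a v))
    have : ω ^ 2 ≤ ‖a v‖ ^ 2 := by gcongr; exact haU v hvU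
    nlinarith
  have hJ := StrongConvexOn.map_sum_le_sub_variance hf.strongConvexOn hf.map_zero hh a
  have hV := le_variance_of_separated hh a hsep hl
  rw [← hzdef] at hJ hV
  set P := ∑ i ∈ U, h i with hP
  set V := ∑ i, h i * ‖a i‖ ^ 2 - ‖z‖ ^ 2 with hVdef
  have hsplit : P + ∑ i ∈ Uᶜ, h i = ∑ i, h i := Finset.sum_add_sum_compl U h
  have hc0 : 0 ≤ ∑ i ∈ Uᶜ, h i := Finset.sum_nonneg fun i _ => hh.1 i
  have hP1 : P ≤ 1 := by linarith [hh.2]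
  have hlP : h l ≤ P := Finset.single_le_sum (fun i _ => hh.1 i) hlU
  have hl0 := hh.1 l
  have hmean : ∑ i, h i * f (a i) ≤ P * f (a v) + (1 - P) * (μ * ω ^ 2 / 4) := by
    rw [← Finset.sum_add_sum_compl U, hP, Finset.sum_mul]
    refine add_le_add (Finset.sum_le_sum fun i hi =>
      mul_le_mul_of_nonneg_left (hv i hi) (hh.1 i)) ?_
    calc ∑ i ∈ Uᶜ, h i * f (a i) ≤ ∑ i ∈ Uᶜ, h i * (μ * ω ^ 2 / 4) :=
          Finset.sum_le_sum fun i hi =>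
            mul_le_mul_of_nonneg_left (hsmall i (Finset.mem_compl.1 hi)) (hh.1 i)
      _ = (∑ i ∈ Uᶜ, h i) * (μ * ω ^ 2 / 4) := (Finset.sum_mul ..).symm
      _ ≤ _ := by gcongr; linarith [hh.2]
  set D := μ * ω ^ 2 with hD
  have hDpos : 0 < D := by positivity
  set e := ε * K * L with he
  have he0 : 0 ≤ e := by positivity
  have hV' : D * (P * (P - h l)) ≤ μ * V := by
    calc D * (P * (P - h l)) = μ * (ω ^ 2 * (P * (P - h l))) := by rw [hD]; ring
      _ ≤ μ * V := by gcongr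
  have hloss : (1 - P) * (D / 4) ≤ (1 - P) * (f (a v) - D / 4) :=
    mul_le_mul_of_nonneg_left (by linarith) (by linarith)
  have key : (1 - P) * (D / 4) + D * (P * (P - h l)) / 2 ≤ 83 / 41 * e := by nlinarith
  have hnn : 0 ≤ D * (P * (P - h l)) :=
    mul_nonneg hDpos.le (mul_nonneg (hl0.trans hlP) (by linarith))
  have hP2 : 1 / 2 ≤ P := by
    by_contra! hlt
    nlinarith
  have : D * (1 / 2 * (P - h l)) ≤ D * (P * (P - h l)) := by
    gcongr
  nlinarith

end Weights

/-! ### Residuals of partially extracted factors -/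

section Residual

variable {κ ι E : Type*} [NormedAddCommGroup E] [InnerProductSpace ℝ E]

/-- The state of the successive projections when, for each `i ∈ S`, the factor column `b i` has
been extracted through the data column `x (τ i)`, up to an error `δ`. The operator `Q` is the one
that carries the data to the current residual. -/
structure IsResidual (b : κ → E) (x : ι → E) (δ : ℝ) (S : Finset κ) (τ : κ → ι)
    (Q : E →ₗ[ℝ] E) : Prop where
  norm_le : ∀ v, ‖Q v‖ ≤ ‖v‖
  map_extracted : ∀ i ∈ S, Q (x (τ i)) = 0
  exists_eq_sub : ∀ v, ∃ y : κ → ℝ, Q v = v - ∑ i ∈ S, y i • x (τ i)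
  dist_le : ∀ i ∈ S, ‖x (τ i) - b i‖ ≤ δ

variable {b : κ → E} {x : ι → E} {δ σ : ℝ} {S : Finset κ} {τ : κ → ι} {Q : E →ₗ[ℝ] E}

lemma IsResidual.norm_map_le (hQ : IsResidual b x δ S τ Q) {i : κ} (hi : i ∈ S) :
    ‖Q (b i)‖ ≤ δ := by
  have : Q (b i) = -Q (x (τ i) - b i) := by rw [map_sub, hQ.map_extracted i hi]; simp
  rw [this, norm_neg]
  exact (hQ.norm_le _).trans (hQ.dist_le i hi)

/-- The residuals of the columns that are not yet extracted keep half of the smallest singular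
value: replacing at most `N` columns by their extracted approximations perturbs the matrix by at
most `√N δ`. -/
lemma IsResidual.le_norm_map_sum [Fintype κ] (hQ : IsResidual b x δ S τ Q) (hσ : 0 ≤ σ)
    (hb : ∀ c : κ → ℝ, σ * √(∑ i, c i ^ 2) ≤ ‖∑ i, c i • b i‖) {N : ℝ} (hS : (S.card : ℝ) ≤ N)
    (hδ : 0 ≤ δ) (hNδ : √N * δ ≤ σ / 2) {c : κ → ℝ} (hc : ∀ i ∈ S, c i = 0) :
    (σ / 2) ^ 2 * ∑ i, c i ^ 2 ≤ ‖Q (∑ i, c i • b i)‖ ^ 2 := by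
  classical
  obtain ⟨y, hy⟩ := hQ.exists_eq_sub (∑ i, c i • b i)
  set z : κ → ℝ := fun i => c i - if i ∈ S then y i else 0 with hz
  have hsq : ∑ i, z i ^ 2 = ∑ i, c i ^ 2 + ∑ i ∈ S, y i ^ 2 := by
    have hind : ∑ i ∈ S, y i ^ 2 = ∑ i, if i ∈ S then y i ^ 2 else 0 := by simp
    rw [hind, ← Finset.sum_add_distrib]
    refine Finset.sum_congr rfl fun i _ => ?_
    by_cases hi : i ∈ S
    · simp [hz, hi, hc i hi]
    · simp [hz, hi]
  have hQz : Q (∑ i, c i • b i) = ∑ i, z i • b i - ∑ i ∈ S, y i • (x (τ i) - b i) := by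
    rw [hy]
    simp only [hz, sub_smul, ite_smul, zero_smul, Finset.sum_sub_distrib, smul_sub,
      Finset.sum_ite_mem, Finset.univ_inter]
    abel
  set Z := √(∑ i, z i ^ 2) with hZ
  have hyZ : √(∑ i ∈ S, y i ^ 2) ≤ Z := Real.sqrt_le_sqrt (by
    rw [hsq]; linarith [Finset.sum_nonneg fun i (_ : i ∈ Finset.univ) => sq_nonneg (c i)])
  have herr : ‖∑ i ∈ S, y i • (x (τ i) - b i)‖ ≤ σ / 2 * Z := by
    calc ‖∑ i ∈ S, y i • (x (τ i) - b i)‖ ≤ ∑ i ∈ S, |y i| * δ :=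
          norm_sum_le_of_le _ fun i hi => by
            rw [norm_smul, Real.norm_eq_abs]
            exact mul_le_mul_of_nonneg_left (hQ.dist_le i hi) (abs_nonneg _)
      _ = (∑ i ∈ S, 1 * |y i|) * δ := by simp [Finset.sum_mul]
      _ ≤ (√(∑ i ∈ S, 1 ^ 2) * √(∑ i ∈ S, |y i| ^ 2)) * δ := by
          gcongr; exact Real.sum_mul_le_sqrt_mul_sqrt S (fun _ => 1) fun i => |y i|
      _ ≤ (√N * Z) * δ := by
          simp only [sq_abs, one_pow, Finset.sum_const, nsmul_eq_mul, mul_one]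
          gcongr
      _ = √N * δ * Z := by ring
      _ ≤ σ / 2 * Z := by gcongr
  have hmain : σ / 2 * Z ≤ ‖Q (∑ i, c i • b i)‖ := by
    rw [hQz]
    have h1 := norm_sub_norm_le (∑ i, z i • b i) (∑ i ∈ S, y i • (x (τ i) - b i))
    have h2 := hb z
    linarith
  have hsc : ∑ i, c i ^ 2 ≤ Z ^ 2 := by
    rw [hZ, Real.sq_sqrt (Finset.sum_nonneg fun i _ => sq_nonneg _), hsq]
    linarith [Finset.sum_nonneg fun i (_ : i ∈ S) => sq_nonneg (y i)]
  calc (σ / 2) ^ 2 * ∑ i, c i ^ 2 ≤ (σ / 2) ^ 2 * Z ^ 2 := by gcongr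
    _ = (σ / 2 * Z) ^ 2 := by ring
    _ ≤ _ := by gcongr

/-- Extracting one more data column `x j`: the residual is projected onto the orthogonal
complement of its column `u = Q (x j)`. -/
lemma IsResidual.insert [DecidableEq κ] (hQ : IsResidual b x δ S τ Q) {j : ι} {l : κ} (hl : l ∉ S)
    (hj : Q (x j) ≠ 0) (hd : ‖x j - b l‖ ≤ δ) {Q' : E →ₗ[ℝ] E}
    (hQ' : ∀ v, Q' v = Q v - ((‖Q (x j)‖ ^ 2)⁻¹ * inner ℝ (Q (x j)) (Q v)) • Q (x j)) :
    IsResidual b x δ (insert l S) (Function.update τ l j) Q' := by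
  have hne : ∀ i ∈ S, i ≠ l := fun i hi h => hl (h ▸ hi)
  have hu : ‖Q (x j)‖ ^ 2 ≠ 0 := by simpa using hj
  refine ⟨fun v => ?_, fun i hi => ?_, fun v => ?_, fun i hi => ?_⟩
  · refine le_trans ?_ (hQ.norm_le v)
    have h : ‖Q' v‖ ^ 2 = ‖Q v‖ ^ 2 - (‖Q (x j)‖ ^ 2)⁻¹ * inner ℝ (Q (x j)) (Q v) ^ 2 := by
      rw [hQ', norm_sub_sq_real, real_inner_smul_right, norm_smul, mul_pow, Real.norm_eq_abs,
        sq_abs, real_inner_comm]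
      field_simp
      ring
    refine le_of_sq_le_sq ?_ (norm_nonneg _)
    rw [h]
    have : 0 ≤ (‖Q (x j)‖ ^ 2)⁻¹ * inner ℝ (Q (x j)) (Q v) ^ 2 := by positivity
    linarith
  · rcases Finset.mem_insert.1 hi with rfl | hi
    · rw [Function.update_self, hQ', real_inner_self_eq_norm_sq, inv_mul_cancel₀ hu, one_smul,
        sub_self]
    · rw [Function.update_of_ne (hne i hi), hQ', hQ.map_extracted i hi]
      simp
  · obtain ⟨y, hy⟩ := hQ.exists_eq_sub v
    obtain ⟨w, hw⟩ := hQ.exists_eq_sub (x j)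
    set β := (‖Q (x j)‖ ^ 2)⁻¹ * inner ℝ (Q (x j)) (Q v) with hβ
    refine ⟨Function.update (fun i => y i - β * w i) l β, ?_⟩
    rw [hQ', Finset.sum_insert hl, Function.update_self, Function.update_self]
    have : ∑ i ∈ S, Function.update (fun i => y i - β * w i) l β i • x (Function.update τ l j i) =
        ∑ i ∈ S, y i • x (τ i) - β • ∑ i ∈ S, w i • x (τ i) := by
      rw [Finset.smul_sum, ← Finset.sum_sub_distrib]
      refine Finset.sum_congr rfl fun i hi => ?_
      rw [Function.update_of_ne (hne i hi), Function.update_of_ne (hne i hi), sub_smul, mul_smul]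
    rw [this, ← hβ, hy, hw, smul_sub]
    abel
  · rcases Finset.mem_insert.1 hi with rfl | hi
    · rwa [Function.update_self]
    · rw [Function.update_of_ne (hne i hi)]
      exact hQ.dist_le i hi

end Residual

/-! ### The recursive algorithm on a noisy factorization -/

section Recursive

lemma norm_sum_smul_sub_le_of_mem_simplex {κ E : Type*} [Fintype κ] [NormedAddCommGroup E]
    [NormedSpace ℝ E] {h : κ → ℝ} (hh : h ∈ simplex κ) {b : κ → E} {K : ℝ} (hb : ∀ i, ‖b i‖ ≤ K)
    (l : κ) : ‖∑ i, h i • b i - b l‖ ≤ 2 * (1 - h l) * K := by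
  classical
  have hK : 0 ≤ K := (norm_nonneg _).trans (hb l)
  have hsum := Finset.add_sum_erase Finset.univ h (Finset.mem_univ l)
  have h1 : ∑ i, h i • b i - b l = ∑ i ∈ Finset.univ.erase l, h i • b i + (h l - 1) • b l := by
    rw [← Finset.add_sum_erase _ _ (Finset.mem_univ l), sub_smul, one_smul]
    abel
  have h2 : ‖∑ i ∈ Finset.univ.erase l, h i • b i‖ ≤ (1 - h l) * K := by
    calc _ ≤ ∑ i ∈ Finset.univ.erase l, h i * K := norm_sum_le_of_le _ fun i _ => by
          rw [norm_smul, Real.norm_of_nonneg (hh.1 i)]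
          exact mul_le_mul_of_nonneg_left (hb i) (hh.1 i)
      _ = (∑ i ∈ Finset.univ.erase l, h i) * K := (Finset.sum_mul ..).symm
      _ ≤ _ := by gcongr; linarith [hh.2]
  have hl : h l ≤ 1 := by
    linarith [hh.2, Finset.sum_nonneg fun i (_ : i ∈ Finset.univ.erase l) => hh.1 i]
  have h3 : ‖(h l - 1) • b l‖ ≤ (1 - h l) * K := by
    rw [norm_smul, Real.norm_eq_abs, abs_of_nonpos (by linarith), neg_sub]
    exact mul_le_mul_of_nonneg_left (hb l) (by linarith)
  rw [h1]
  exact (norm_add_le _ _).trans (by linarith)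

/-- The columns of `M` are, up to noise of size `ε`, combinations of the columns `b i` with weights
`h k` in the simplex, and the column `e i` of `M` is the noisy copy of `b i`. The matrix with
columns `b i` has smallest singular value at least `σ` and columns of norm at most `K`; the
remaining fields say that the noise is small enough for the recursive algorithm run with `f` to
recover every `b i` up to `δ`. -/
structure NoisyFactorization {m : ℕ} {κ ι : Type*} [Fintype κ] [DecidableEq κ]
    (f : EuclideanSpace ℝ (Fin m) → ℝ) (M : Matrix (Fin m) ι ℝ)
    (b : κ → EuclideanSpace ℝ (Fin m)) (h : ι → κ → ℝ) (e : κ → ι) (μ L σ K ε δ : ℝ) : Prop where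
  admissible : IsAdmissible f μ L
  L_nonneg : 0 ≤ L
  weight_mem : ∀ k, h k ∈ simplex κ
  weight_copy : ∀ i, h (e i) = Pi.single i 1
  noise_le : ∀ k, ‖colVec M k - ∑ i, h k i • b i‖ ≤ ε
  σ_pos : 0 < σ
  σ_mul_le : ∀ c : κ → ℝ, σ * √(∑ i, c i ^ 2) ≤ ‖∑ i, c i • b i‖
  norm_le : ∀ i, ‖b i‖ ≤ K
  ε_nonneg : 0 ≤ ε
  ε_lt_σ : 2 * ε < σ
  ε_le_K : 82 * ε ≤ K
  noise_small : 160 * (ε * K * L) ≤ μ * σ ^ 2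
  le_δ : 80 * (ε * K ^ 2 * L) ≤ μ * σ ^ 2 * (δ - ε)
  sqrt_mul_δ_le : √((Fintype.card κ : ℝ) - 1) * δ ≤ σ / 2
  L_mul_δ_le : L * δ ^ 2 ≤ μ * σ ^ 2 / 16

variable {m : ℕ} {κ ι : Type*} [Fintype κ] [DecidableEq κ]
  {f : EuclideanSpace ℝ (Fin m) → ℝ} {M : Matrix (Fin m) ι ℝ}
  {b : κ → EuclideanSpace ℝ (Fin m)} {h : ι → κ → ℝ} {e : κ → ι} {μ L σ K ε δ : ℝ}

namespace NoisyFactorization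

lemma ε_le_δ (F : NoisyFactorization f M b h e μ L σ K ε δ) : ε ≤ δ := by
  have h1 := F.le_δ
  have h2 := F.ε_nonneg
  have h3 := F.L_nonneg
  have h4 := F.σ_pos
  have h5 := F.admissible.mu_pos
  have h6 : 0 ≤ μ * σ ^ 2 * (δ - ε) := le_trans (by positivity) h1
  have := nonneg_of_mul_nonneg_right h6 (by positivity)
  linarith

lemma noise_copy_le (F : NoisyFactorization f M b h e μ L σ K ε δ) (i : κ) :
    ‖colVec M (e i) - b i‖ ≤ ε := by
  simpa [F.weight_copy, Pi.single_apply] using F.noise_le (e i)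

variable {S : Finset κ} {τ : κ → ι}
  {Q : EuclideanSpace ℝ (Fin m) →ₗ[ℝ] EuclideanSpace ℝ (Fin m)}

lemma le_norm_residual_sum (F : NoisyFactorization f M b h e μ L σ K ε δ)
    (hQ : IsResidual b (colVec M) δ S τ Q) (hS : S.card < Fintype.card κ) {c : κ → ℝ}
    (hc : ∀ i ∈ S, c i = 0) :
    (σ / 2) ^ 2 * ∑ i, c i ^ 2 ≤ ‖Q (∑ i, c i • b i)‖ ^ 2 := by
  refine hQ.le_norm_map_sum F.σ_pos.le F.σ_mul_le ?_ (F.ε_nonneg.trans F.ε_le_δ)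
    F.sqrt_mul_δ_le hc
  have : (S.card : ℝ) + 1 ≤ Fintype.card κ := by exact_mod_cast hS
  linarith

lemma le_norm_residual (F : NoisyFactorization f M b h e μ L σ K ε δ)
    (hQ : IsResidual b (colVec M) δ S τ Q) (hS : S.card < Fintype.card κ) {i : κ} (hi : i ∉ S) :
    σ / 2 ≤ ‖Q (b i)‖ := by
  have h1 := F.le_norm_residual_sum hQ hS (c := Pi.single i 1) fun j hj => by
    rw [Pi.single_eq_of_ne]; rintro rfl; exact hi hj
  simp only [Pi.single_apply, ite_pow, one_pow, ne_eq, OfNat.ofNat_ne_zero, not_false_eq_true,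
    zero_pow, Finset.sum_ite_eq', Finset.mem_univ, if_true, mul_one, ite_smul, one_smul,
    zero_smul] at h1
  exact le_of_sq_le_sq h1 (norm_nonneg _)

lemma le_norm_residual_sub (F : NoisyFactorization f M b h e μ L σ K ε δ)
    (hQ : IsResidual b (colVec M) δ S τ Q) (hS : S.card < Fintype.card κ) {i j : κ} (hi : i ∉ S)
    (hj : j ∉ S) (hij : i ≠ j) : 2 * (σ / 2) ^ 2 ≤ ‖Q (b i) - Q (b j)‖ ^ 2 := by
  have h1 := F.le_norm_residual_sum hQ hS (c := Pi.single i 1 - Pi.single j 1) fun l hl => by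
    rw [Pi.sub_apply, Pi.single_eq_of_ne, Pi.single_eq_of_ne, sub_zero]
    · rintro rfl; exact hj hl
    · rintro rfl; exact hi hl
  have h2 : ∑ l, (Pi.single i 1 - Pi.single j 1 : κ → ℝ) l ^ 2 = 2 := by
    have : ∀ l, (Pi.single i 1 - Pi.single j 1 : κ → ℝ) l ^ 2 =
        (if l = i then 1 else 0) + if l = j then 1 else 0 := by
      intro l
      simp only [Pi.sub_apply, Pi.single_apply]
      by_cases h1 : l = i <;> by_cases h2 : l = j <;> simp_all
    simp only [this, Finset.sum_add_distrib, Finset.sum_ite_eq', Finset.mem_univ, if_true]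
    norm_num
  have h3 : ∑ l, (Pi.single i 1 - Pi.single j 1 : κ → ℝ) l • b l = b i - b j := by
    simp [sub_smul, Finset.sum_sub_distrib, Pi.single_apply]
  rw [h2, h3, map_sub] at h1
  linarith

/-- Before all factor columns are extracted, the noise does not hide what is left of them. -/
lemma exists_residual_ne_zero (F : NoisyFactorization f M b h e μ L σ K ε δ)
    (hQ : IsResidual b (colVec M) δ S τ Q) (hS : S.card < Fintype.card κ) :
    ∃ k, Q (colVec M k) ≠ 0 := by
  obtain ⟨i, hi⟩ : ∃ i, i ∉ S := by
    by_contra! hall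
    rw [Finset.eq_univ_of_forall hall, Finset.card_univ] at hS
    exact lt_irrefl _ hS
  refine ⟨e i, fun h0 => ?_⟩
  have h1 := F.le_norm_residual hQ hS hi
  have h2 := (hQ.norm_le _).trans (F.noise_copy_le i)
  rw [map_sub, h0, zero_sub, norm_neg] at h2
  linarith [F.ε_lt_σ]

/-- Robustness of one pass: a column on which `f` is maximal in the residual is close to a factor
column that has not been extracted yet. -/
lemma exists_close_of_isSelected (F : NoisyFactorization f M b h e μ L σ K ε δ)
    (hQ : IsResidual b (colVec M) δ S τ Q) (hS : S.card < Fintype.card κ)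
    {R : Matrix (Fin m) ι ℝ} (hR : ∀ k, colVec R k = Q (colVec M k)) {j : ι}
    (hj : IsSelected f M R j) :
    Q (colVec M j) ≠ 0 ∧ ∃ l ∉ S, ‖colVec M j - b l‖ ≤ δ := by
  have hf := F.admissible
  have hμ := hf.mu_pos
  have hσ := F.σ_pos
  constructor
  · intro h0
    obtain ⟨k, hk⟩ := F.exists_residual_ne_zero hQ hS
    have h1 := hj.1 k
    rw [hR, hR, h0, hf.map_zero] at h1
    have h2 := hf.mul_norm_sq_le (Q (colVec M k))
    have h3 : 0 < ‖Q (colVec M k)‖ := norm_pos_iff.2 hk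
    have : 0 < μ / 2 * ‖Q (colVec M k)‖ ^ 2 := by positivity
    linarith
  have hU : (Sᶜ).Nonempty := by
    rw [← Finset.card_pos, Finset.card_compl]; omega
  have hK : 0 ≤ K := by linarith [F.ε_nonneg, F.ε_le_K]
  obtain ⟨l, hl, hw⟩ := hf.exists_large_weight (ε := ε) (K := K) (ω := σ / 2)
    (a := fun i => Q (b i)) F.L_nonneg (F.weight_mem j) hU F.ε_nonneg (by positivity) F.ε_le_K
    (by linarith [F.noise_small]) (fun i => (hQ.norm_le _).trans (F.norm_le i))
    (fun i hi => F.le_norm_residual hQ hS (Finset.mem_compl.1 hi))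
    (fun i hi i' hi' hne => F.le_norm_residual_sub hQ hS (Finset.mem_compl.1 hi)
      (Finset.mem_compl.1 hi') hne)
    (fun i hi => by
      refine (hf.le_mul_norm_sq F.L_nonneg _).trans ?_
      have h1 := hQ.norm_map_le (by simpa using hi)
      have h2 : ‖Q (b i)‖ ^ 2 ≤ δ ^ 2 := by gcongr
      linarith [F.L_mul_δ_le, mul_le_mul_of_nonneg_left h2 F.L_nonneg])
    (x := Q (colVec M j))
    (by
      have : ∑ i, h j i • Q (b i) = Q (∑ i, h j i • b i) := by simp
      rw [this, ← map_sub]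
      exact (hQ.norm_le _).trans (F.noise_le j))
    (fun i _ => ⟨Q (colVec M (e i)), by
      rw [← map_sub]; exact (hQ.norm_le _).trans (F.noise_copy_le i), by
      rw [← hR, ← hR]; exact hj.1 _⟩)
  refine ⟨l, Finset.mem_compl.1 hl, ?_⟩
  have h1 := norm_sum_smul_sub_le_of_mem_simplex (F.weight_mem j) F.norm_le l
  have h2 : μ * σ ^ 2 * (2 * (1 - h j l) * K) ≤ μ * σ ^ 2 * (δ - ε) := by
    refine le_trans ?_ F.le_δ
    nlinarith [mul_le_mul_of_nonneg_left hw hK]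
  have h3 := le_of_mul_le_mul_left h2 (by positivity)
  calc ‖colVec M j - b l‖
      = ‖(colVec M j - ∑ i, h j i • b i) + (∑ i, h j i • b i - b l)‖ := by congr 1; abel
    _ ≤ ε + (δ - ε) := (norm_add_le _ _).trans (add_le_add (F.noise_le j) (h1.trans h3))
    _ = δ := by ring

end NoisyFactorization

lemma colVec_deflate (R : Matrix (Fin m) ι ℝ) (j k : ι) :
    colVec (deflate R j) k =
      colVec R k - ((‖colVec R j‖ ^ 2)⁻¹ * inner ℝ (colVec R j) (colVec R k)) • colVec R j := by
  ext i
  rw [deflate, Matrix.sub_mul, Matrix.one_mul, Matrix.smul_mul]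
  simp only [colVec, Matrix.sub_apply,
    Matrix.smul_apply, Matrix.mul_apply, Matrix.vecMulVec_apply, PiLp.sub_apply, PiLp.smul_apply,
    smul_eq_mul, PiLp.inner_apply, RCLike.inner_apply, conj_trivial, Finset.mul_sum,
    Finset.sum_mul]
  congr 1
  exact Finset.sum_congr rfl fun l _ => by ring

lemma NoisyFactorization.exists_isResidual [DecidableEq ι]
    (F : NoisyFactorization f M b h e μ L σ K ε δ) {c : ℕ} {R : Matrix (Fin m) ι ℝ}
    {J : Finset ι} (hRJ : Reaches f M c R J) (hc : c ≤ Fintype.card κ) :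
    ∃ (S : Finset κ) (τ : κ → ι) (Q : EuclideanSpace ℝ (Fin m) →ₗ[ℝ] EuclideanSpace ℝ (Fin m)),
      IsResidual b (colVec M) δ S τ Q ∧ S.card = c ∧ J = S.image τ ∧ J.card = c ∧
        ∀ k, colVec R k = Q (colVec M k) := by
  induction hRJ with
  | init => exact ⟨∅, e, LinearMap.id, ⟨by simp, by simp, fun v => ⟨0, by simp⟩, by simp⟩, rfl,
      by simp, rfl, by simp⟩
  | @step c R J j _ _ hj ih =>
    obtain ⟨S, τ, Q, hQ, hS, rfl, hJ, hR⟩ := ih (by omega)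
    obtain ⟨hne, l, hl, hd⟩ := F.exists_close_of_isSelected hQ (by omega) hR hj
    set u := Q (colVec M j) with hu
    refine ⟨insert l S, Function.update τ l j,
      Q - (((‖u‖ ^ 2)⁻¹ • (innerₛₗ ℝ u)).smulRight u) ∘ₗ Q,
      hQ.insert hl hne hd fun v => by simp [hu], ?_, ?_, ?_, fun k => ?_⟩
    · rw [Finset.card_insert_of_notMem hl, hS]
    · rw [Finset.image_insert, Function.update_self]
      congr 1
      refine Finset.image_congr fun i hi => ?_
      rw [Function.update_of_ne]
      rintro rfl; exact hl hi
    · rw [Finset.card_insert_of_notMem, hJ]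
      intro hmem
      obtain ⟨i, hi, rfl⟩ := Finset.mem_image.1 hmem
      exact hne (hQ.map_extracted i hi)
    · rw [colVec_deflate, hR, hR]
      simp [hu]

lemma ne_zero_of_colVec_ne_zero {R : Matrix (Fin m) ι ℝ} {k : ι} (hk : colVec R k ≠ 0) :
    R ≠ 0 := by
  rintro rfl
  exact hk (by ext; simp [colVec])

/-- The data columns extracted by the recursive algorithm are in bijection with the factor
columns, each within `δ` of its partner. -/
lemma NoisyFactorization.exists_injective_of_isRecursiveOutput [DecidableEq ι]
    (F : NoisyFactorization f M b h e μ L σ K ε δ) {J : Finset ι}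
    (hJ : IsRecursiveOutput f M (Fintype.card κ) J) :
    ∃ τ : κ → ι, Function.Injective τ ∧ J = Finset.univ.image τ ∧
      ∀ i, ‖colVec M (τ i) - b i‖ ≤ δ := by
  obtain ⟨c, R, hRJ, hc, hfin⟩ := hJ
  obtain ⟨S, τ, Q, hQ, hS, rfl, hJ, hR⟩ := F.exists_isResidual hRJ hc
  have hcs : c = Fintype.card κ := by
    rcases hfin with h0 | h0
    · by_contra hne
      obtain ⟨k, hk⟩ := F.exists_residual_ne_zero hQ (by omega)
      exact ne_zero_of_colVec_ne_zero (hR k ▸ hk) h0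
    · exact h0
  have hSu : S = Finset.univ := Finset.card_eq_iff_eq_univ S |>.1 (hS.trans hcs)
  subst hSu
  refine ⟨τ, ?_, rfl, fun i => hQ.dist_le i (Finset.mem_univ i)⟩
  have hinj := Finset.card_image_iff.1 (hJ.trans hS.symm)
  rwa [Finset.coe_univ, Set.injOn_univ] at hinj

lemma exists_isSelected [Finite ι] [Nonempty ι] (f : EuclideanSpace ℝ (Fin m) → ℝ)
    (M R : Matrix (Fin m) ι ℝ) : ∃ j, IsSelected f M R j := by
  obtain ⟨j, hj⟩ := Finite.exists_max fun j => toLex (f (colVec R j), f (colVec M j))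
  have hj' := fun k => Prod.Lex.le_iff.1 (hj k)
  simp only [ofLex_toLex] at hj'
  refine ⟨j, fun k => ?_, fun k hk => ?_⟩
  · rcases hj' k with h | h
    · exact h.le
    · exact h.1.le
  · rcases hj' k with h | h
    · exact absurd hk h.ne
    · exact h.2

lemma NoisyFactorization.exists_isRecursiveOutput [Finite ι] [DecidableEq ι]
    (F : NoisyFactorization f M b h e μ L σ K ε δ) :
    ∃ J, IsRecursiveOutput f M (Fintype.card κ) J := by
  have key : ∀ c ≤ Fintype.card κ, ∃ R J, Reaches f M c R J := by
    intro c
    induction c with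
    | zero => exact fun _ => ⟨M, ∅, .init⟩
    | succ c ih =>
      intro hc
      obtain ⟨R, J, hRJ⟩ := ih (by omega)
      obtain ⟨S, τ, Q, hQ, hS, -, -, hR⟩ := F.exists_isResidual hRJ (by omega)
      obtain ⟨k, hk⟩ := F.exists_residual_ne_zero hQ (by omega)
      have : Nonempty ι := ⟨k⟩
      obtain ⟨j, hj⟩ := exists_isSelected f M R
      exact ⟨_, _, hRJ.step (ne_zero_of_colVec_ne_zero (hR k ▸ hk)) hj⟩
  obtain ⟨R, J, hRJ⟩ := key _ le_rfl
  exact ⟨J, _, R, hRJ, le_rfl, Or.inr rfl⟩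

end Recursive

/-! ### The smallest singular value -/

section SingularValue

lemma singularValues_mul_norm_le {E F : Type*} [NormedAddCommGroup E] [InnerProductSpace ℝ E]
    [FiniteDimensional ℝ E] [NormedAddCommGroup F] [InnerProductSpace ℝ F]
    [FiniteDimensional ℝ F] (T : E →ₗ[ℝ] F) {n : ℕ} (hn : Module.finrank ℝ E = n + 1) (v : E) :
    T.singularValues n * ‖v‖ ≤ ‖T v‖ := by
  have hT := T.isSymmetric_adjoint_comp_self
  have h1 : ‖T v‖ ^ 2 = ∑ i, hT.eigenvalues hn i * inner ℝ (hT.eigenvectorBasis hn i) v ^ 2 := by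
    rw [← real_inner_self_eq_norm_sq, ← LinearMap.adjoint_inner_left, real_inner_comm,
      ← (hT.eigenvectorBasis hn).sum_inner_mul_inner]
    refine Finset.sum_congr rfl fun i _ => ?_
    have h2 : inner ℝ (hT.eigenvectorBasis hn i) (LinearMap.adjoint T (T v)) =
        hT.eigenvalues hn i * inner ℝ (hT.eigenvectorBasis hn i) v := by
      rw [← LinearMap.comp_apply, ← hT, hT.apply_eigenvectorBasis, real_inner_smul_left]
      rfl
    rw [h2, real_inner_comm]
    ring
  have h3 : T.singularValues n ^ 2 * ‖v‖ ^ 2 ≤ ‖T v‖ ^ 2 := by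
    rw [h1, ← (hT.eigenvectorBasis hn).sum_sq_norm_inner_right v, Finset.mul_sum]
    refine Finset.sum_le_sum fun i _ => ?_
    rw [Real.norm_eq_abs, sq_abs]
    refine mul_le_mul_of_nonneg_right ?_ (sq_nonneg _)
    rw [T.sq_singularValues_of_lt hn (Nat.lt_succ_self n)]
    exact hT.eigenvalues_antitone hn (Fin.le_last i)
  rw [← mul_pow] at h3
  exact le_of_sq_le_sq h3 (norm_nonneg _)

lemma sigma_mul_sqrt_le {m : ℕ} {κ : Type*} [Fintype κ] [DecidableEq κ]
    (B : Matrix (Fin m) κ ℝ) (hκ : 0 < Fintype.card κ) (c : κ → ℝ) :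
    sigma (Fintype.card κ) B * √(∑ i, c i ^ 2) ≤ ‖∑ i, c i • colVec B i‖ := by
  have h := singularValues_mul_norm_le (Matrix.toEuclideanLin B) (n := Fintype.card κ - 1)
    (by simp; omega) (WithLp.toLp 2 c)
  have h1 : Matrix.toEuclideanLin B (WithLp.toLp 2 c) = ∑ i, c i • colVec B i := by
    ext i
    simp [colVec, Matrix.mulVec, dotProduct, mul_comm]
  rw [h1, EuclideanSpace.norm_eq] at h
  simp only [Real.norm_eq_abs, sq_abs] at h
  exact h

end SingularValue

/-! ### Scores of the extracted columns -/

section Scores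

variable {m : ℕ} {κ ι : Type*}

lemma colVec_sub_submatrix_mul {J : Finset ι} (M : Matrix (Fin m) ι ℝ)
    (X : Matrix {i // i ∈ J} ι ℝ) (k : ι) :
    colVec (M - M.submatrix id Subtype.val * X) k =
      colVec M k - ∑ i, X i k • colVec M i := by
  ext l
  -- The product with a submatrix elaborates to the heterogeneous product of `CStarMatrix`, which is
  -- given by the same formula as that of matrices.
  change M l k - ∑ i : {i // i ∈ J}, M l i * X i k = _
  simp [colVec, mul_comm]

lemma frobeniusSq_eq_sum_norm_colVec [Fintype ι] (X : Matrix (Fin m) ι ℝ) :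
    frobeniusSq X = ∑ k, ‖colVec X k‖ ^ 2 := by
  simp only [frobeniusSq, EuclideanSpace.norm_sq_eq, colVec, Real.norm_eq_abs, sq_abs]
  exact Finset.sum_comm

/-- The Frobenius objective decouples, so that each column of a minimizer is optimal. -/
lemma IsAbundance.norm_colVec_sub_le [Fintype ι] {M : Matrix (Fin m) ι ℝ} {J : Finset ι}
    {G : Matrix {i // i ∈ J} ι ℝ} (hG : IsAbundance M J G) (k : ι) {x : {i // i ∈ J} → ℝ}
    (hx : x ∈ simplex {i // i ∈ J}) :
    ‖colVec M k - ∑ i, G i k • colVec M i‖ ≤ ‖colVec M k - ∑ i, x i • colVec M i‖ := by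
  classical
  have h := hG.2 (G.updateCol k x) fun l => by
    by_cases hl : l = k
    · subst hl; simpa using hx
    · simpa [Matrix.updateCol_apply, hl] using hG.1 l
  simp only [frobeniusSq_eq_sum_norm_colVec, colVec_sub_submatrix_mul] at h
  rw [← Finset.add_sum_erase _ _ (Finset.mem_univ k),
    ← Finset.add_sum_erase (a := k) (f := fun l => ‖colVec M l -
      ∑ i, G.updateCol k x i l • colVec M i‖ ^ 2) _ (Finset.mem_univ k)] at h
  have e : ∑ l ∈ Finset.univ.erase k, ‖colVec M l - ∑ i, G.updateCol k x i l • colVec M i‖ ^ 2 =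
      ∑ l ∈ Finset.univ.erase k, ‖colVec M l - ∑ i, G i l • colVec M i‖ ^ 2 :=
    Finset.sum_congr rfl fun l hl => by
      simp [Finset.ne_of_mem_erase hl]
  rw [e] at h
  simp only [Matrix.updateCol_self] at h
  exact le_of_sq_le_sq (by linarith) (norm_nonneg _)

lemma exists_isAbundance [Fintype ι] (M : Matrix (Fin m) ι ℝ) (J : Finset ι) :
    ∃ G, IsAbundance M J G := by
  set C : Set (Matrix {i // i ∈ J} ι ℝ) :=
    {X | ∀ k, (fun i => X i k) ∈ simplex {i // i ∈ J}} with hC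
  have hclosed : IsClosed C := by
    have : C = ⋂ k, ((⋂ i, {X : Matrix {i // i ∈ J} ι ℝ | 0 ≤ X i k}) ∩
        {X : Matrix {i // i ∈ J} ι ℝ | ∑ i, X i k ≤ 1}) := by
      ext X; simp [hC, simplex]
    rw [this]
    refine isClosed_iInter fun k => (isClosed_iInter fun i => ?_).inter ?_
    · exact isClosed_le continuous_const (by fun_prop)
    · exact isClosed_le (by fun_prop) continuous_const
  have hcompact : IsCompact C := by
    refine (isCompact_univ_pi fun _ => isCompact_univ_pi fun _ =>
      isCompact_Icc (a := (0 : ℝ)) (b := 1)).of_isClosed_subset hclosed ?_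
    intro X hX i _ k _
    exact ⟨(hX k).1 i, (Finset.single_le_sum (fun j _ => (hX k).1 j)
      (Finset.mem_univ i)).trans (hX k).2⟩
  have hne : C.Nonempty := ⟨0, fun k => ⟨fun i => le_rfl, by simp⟩⟩
  have hcont : Continuous fun X : Matrix {i // i ∈ J} ι ℝ =>
      frobeniusSq (M - M.submatrix id Subtype.val * X) := by
    simp only [frobeniusSq_eq_sum_norm_colVec, colVec_sub_submatrix_mul]
    fun_prop
  obtain ⟨G, hG, hmin⟩ := hcompact.exists_isMinOn hne hcont.continuousOn
  exact ⟨G, hG, fun X hX => hmin hX⟩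

lemma isTopRows_iff_of_separated [Fintype ι] {J A J' : Finset ι} {G : Matrix {i // i ∈ J} ι ℝ}
    (hA : A ⊆ J)
    (hsep : ∀ a b : {i // i ∈ J}, a.1 ∈ A → b.1 ∉ A → rowNormOne G b < rowNormOne G a) :
    IsTopRows A.card J G J' ↔ J' = A := by
  constructor
  · rintro ⟨hJ, hcard, htop⟩
    refine Finset.eq_of_subset_of_card_le (fun b hb => ?_) hcard.ge
    by_contra hbA
    obtain ⟨a, ha, haJ'⟩ : ∃ a ∈ A, a ∉ J' := by
      by_contra! hall
      exact hbA ((Finset.eq_of_subset_of_card_le hall hcard.le).symm ▸ hb)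
    exact (htop ⟨b, hJ hb⟩ ⟨a, hA ha⟩ hb haJ').not_gt (hsep ⟨a, hA ha⟩ ⟨b, hJ hb⟩ ha hbA)
  · rintro rfl
    exact ⟨hA, rfl, fun a b ha hb => (hsep a b ha hb).le⟩

variable [Fintype κ] [DecidableEq κ]
  {f : EuclideanSpace ℝ (Fin m) → ℝ} {M : Matrix (Fin m) ι ℝ}
  {b : κ → EuclideanSpace ℝ (Fin m)} {h : ι → κ → ℝ} {e : κ → ι} {μ L σ K ε δ : ℝ}

/-- An approximate representation of a data column in terms of the extracted columns has weights
close to the true ones. -/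
lemma NoisyFactorization.abs_weight_sub_le (F : NoisyFactorization f M b h e μ L σ K ε δ)
    {τ : κ → ι} (hτ : ∀ i, ‖colVec M (τ i) - b i‖ ≤ δ) {k : ι} {g : κ → ℝ} (hg : g ∈ simplex κ)
    {ρ : ℝ} (hρ : ‖colVec M k - ∑ i, g i • colVec M (τ i)‖ ≤ ρ) (i : κ) :
    |g i - h k i| ≤ (ρ + ε + δ) / σ := by
  have h1 : ∑ i, (g - h k) i • b i = (colVec M k - ∑ i, h k i • b i) -
      (colVec M k - ∑ i, g i • colVec M (τ i)) - ∑ i, g i • (colVec M (τ i) - b i) := by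
    simp only [Pi.sub_apply, sub_smul, smul_sub, Finset.sum_sub_distrib]
    abel
  have h2 : ‖∑ i, (g - h k) i • b i‖ ≤ ρ + ε + δ := by
    rw [h1]
    have h3 := norm_sub_le ((colVec M k - ∑ i, h k i • b i) -
      (colVec M k - ∑ i, g i • colVec M (τ i))) (∑ i, g i • (colVec M (τ i) - b i))
    have h4 := norm_sub_le (colVec M k - ∑ i, h k i • b i)
      (colVec M k - ∑ i, g i • colVec M (τ i))
    have h5 := norm_sum_smul_le_of_mem_simplex hg (F.ε_nonneg.trans F.ε_le_δ) hτ
    linarith [F.noise_le k]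
  rw [le_div_iff₀ F.σ_pos, mul_comm]
  refine le_trans ?_ ((F.σ_mul_le (g - h k)).trans h2)
  have h6 : |(g - h k) i| ≤ √(∑ j, (g - h k) j ^ 2) := by
    rw [← Real.sqrt_sq_eq_abs]
    exact Real.sqrt_le_sqrt (Finset.single_le_sum (f := fun j => (g - h k) j ^ 2)
      (fun j _ => sq_nonneg _) (Finset.mem_univ i))
  exact mul_le_mul_of_nonneg_left h6 F.σ_pos.le

/-- The score of an extracted column is close to the total weight of its factor column. The error
is half as large on the `card κ` extracted columns, which are represented exactly. -/
lemma NoisyFactorization.abs_rowNormOne_sub_le [Fintype ι]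
    (F : NoisyFactorization f M b h e μ L σ K ε δ)
    {τ : κ → ι} (hτ : ∀ i, ‖colVec M (τ i) - b i‖ ≤ δ) {J : Finset ι}
    (u : κ ≃ {i // i ∈ J}) (hu : ∀ i, (u i).1 = τ i)
    {G : Matrix {i // i ∈ J} ι ℝ} (hG : IsAbundance M J G) (i : κ) :
    |rowNormOne G (u i) - ∑ k, h k i| ≤
      (2 * Fintype.card ι - Fintype.card κ) * ((δ + ε) / σ) := by
  have hmem : ∀ y : {i // i ∈ J} → ℝ,
      y ∘ u ∈ simplex κ ↔ y ∈ simplex {i // i ∈ J} := fun y => by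
    refine and_congr ⟨fun hy j => ?_, fun hy i => hy (u i)⟩ (by
      rw [← u.sum_comp y]; exact Iff.rfl)
    simpa using hy (u.symm j)
  have hsum : ∀ y : {i // i ∈ J} → ℝ,
      ∑ j, y j • colVec M j = ∑ i, (y ∘ u) i • colVec M (τ i) := fun y => by
    rw [← u.sum_comp fun j => y j • colVec M j]
    simp only [hu, Function.comp_apply]
  have hopt : ∀ k, ∀ y ∈ simplex κ, ‖colVec M k - ∑ i, G (u i) k • colVec M (τ i)‖ ≤
      ‖colVec M k - ∑ i, y i • colVec M (τ i)‖ := fun k y hy => by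
    have hy' : (y ∘ u.symm) ∘ u = y := by ext; simp
    have h1 := hG.norm_colVec_sub_le k ((hmem (y ∘ u.symm)).1 (hy'.symm ▸ hy))
    rw [hsum fun j => G j k, hsum, hy'] at h1
    exact h1
  have hδ : 0 ≤ δ := F.ε_nonneg.trans F.ε_le_δ
  classical
  have hcol : ∀ k, |G (u i) k - h k i| ≤
      2 * ((δ + ε) / σ) - if k ∈ J then (δ + ε) / σ else 0 := by
    intro k
    have hg := (hmem fun j => G j k).2 (hG.1 k)
    split_ifs with hk
    · obtain ⟨l, rfl⟩ : ∃ l, τ l = k := ⟨u.symm ⟨k, hk⟩, by rw [← hu, u.apply_symm_apply]⟩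
      have h0 := hopt (τ l) (Pi.single l 1)
        ⟨fun j => by rw [Pi.single_apply]; split_ifs <;> norm_num, by simp⟩
      have h1 : ∑ j, (Pi.single l 1 : κ → ℝ) j • colVec M (τ j) = colVec M (τ l) := by
        simp [Pi.single_apply]
      rw [h1, sub_self, norm_zero] at h0
      refine (F.abs_weight_sub_le hτ hg h0 i).trans_eq ?_
      ring
    · have h0 := hopt k (h k) (F.weight_mem k)
      have h1 : colVec M k - ∑ j, h k j • colVec M (τ j) = (colVec M k - ∑ j, h k j • b j) -
          ∑ j, h k j • (colVec M (τ j) - b j) := by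
        simp only [smul_sub, Finset.sum_sub_distrib]; abel
      have h2 : ‖colVec M k - ∑ j, h k j • colVec M (τ j)‖ ≤ ε + δ := by
        rw [h1]
        exact (norm_sub_le _ _).trans (add_le_add (F.noise_le k)
          (norm_sum_smul_le_of_mem_simplex (F.weight_mem k) hδ hτ))
      refine (F.abs_weight_sub_le hτ hg (h0.trans h2) i).trans_eq ?_
      ring
  have hrow : rowNormOne G (u i) = ∑ k, G (u i) k :=
    Finset.sum_congr rfl fun k _ => abs_of_nonneg ((hG.1 k).1 _)
  rw [hrow, ← Finset.sum_sub_distrib]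
  refine (Finset.abs_sum_le_sum_abs _ _).trans ((Finset.sum_le_sum fun k _ => hcol k).trans_eq ?_)
  rw [Finset.sum_sub_distrib, Finset.sum_ite_mem, Finset.univ_inter, Finset.sum_const,
    Finset.sum_const, ← Fintype.card_coe J, ← Fintype.card_congr u, Finset.card_univ]
  simp only [nsmul_eq_mul]
  ring

end Scores

/-! ### Separable matrices with outliers -/

section Outliers

/-- The noise bound in terms of the condition of the factor turns into the numerical conditions
under which the recursive algorithm is robust. -/
lemma noisyFactorization_of_lt {m : ℕ} {κ ι : Type*} [Fintype κ] [DecidableEq κ]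
    {f : EuclideanSpace ℝ (Fin m) → ℝ} {μ L : ℝ} (hf : IsAdmissible f μ L)
    (hκ : 2 ≤ Fintype.card κ) {B : Matrix (Fin m) κ ℝ} {M : Matrix (Fin m) ι ℝ} {h : ι → κ → ℝ}
    {e : κ → ι} {ε δ : ℝ} (hh : ∀ k, h k ∈ simplex κ) (he : ∀ i, h (e i) = Pi.single i 1)
    (hnoise : ∀ k, ‖colVec M k - ∑ i, h k i • colVec B i‖ ≤ ε)
    (hε : ε < sigma (Fintype.card κ) B *
      min (1 / (2 * √((Fintype.card κ : ℝ) - 1))) (1 / 4 * √(μ / L)) *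
      (1 + 80 * (maxColNorm B ^ 2 / sigma (Fintype.card κ) B ^ 2) * (L / μ))⁻¹)
    (hδ : δ = ε * (1 + 80 * (maxColNorm B ^ 2 / sigma (Fintype.card κ) B ^ 2) * (L / μ))) :
    NoisyFactorization f M (colVec B) h e μ L (sigma (Fintype.card κ) B) (maxColNorm B) ε δ := by
  have hσB := sigma_mul_sqrt_le B (by omega)
  set σ := sigma (Fintype.card κ) B with hσdef
  set K := maxColNorm B with hKdef
  have hKB : ∀ i, ‖colVec B i‖ ≤ K := fun i =>
    le_ciSup (f := fun j => ‖colVec B j‖) (Set.finite_range _).bddAbove i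
  obtain ⟨i₀⟩ : Nonempty κ := Fintype.card_pos_iff.1 (by omega)
  have hσK : σ ≤ K := by
    have h1 := hσB (Pi.single i₀ 1)
    simp only [Pi.single_apply, ite_pow, one_pow, ne_eq, OfNat.ofNat_ne_zero, not_false_eq_true,
      zero_pow, Finset.sum_ite_eq', Finset.mem_univ, if_true, ite_smul, one_smul,
      zero_smul, Real.sqrt_one, mul_one] at h1
    exact h1.trans (hKB i₀)
  have hε0 : 0 ≤ ε := (norm_nonneg _).trans (hnoise (e i₀))
  have hσ0 : 0 ≤ σ := LinearMap.singularValues_nonneg _ _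
  have hσ : 0 < σ := by
    refine hσ0.lt_of_ne fun h0 => ?_
    rw [← h0, zero_mul, zero_mul] at hε
    linarith
  have hK : 0 < K := hσ.trans_le hσK
  have hμ := hf.mu_pos
  obtain ⟨hL, hμL⟩ : 0 < L ∧ μ ≤ 2 * L := by
    refine hf.lipschitz_pos (x := colVec B i₀) fun h0 => ?_
    have h1 := hσB (Pi.single i₀ 1)
    simp [Pi.single_apply, h0] at h1
    linarith
  set X := K ^ 2 / σ ^ 2 * (L / μ) with hX
  have hXσ : X * (μ * σ ^ 2) = K ^ 2 * L := by rw [hX]; field_simp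
  have hX0 : 0 < X := by positivity
  have hXhalf : 1 / 2 ≤ X := by
    have h1 : 1 ≤ K ^ 2 / σ ^ 2 := by rw [one_le_div (by positivity)]; gcongr
    have h2 : 1 / 2 ≤ L / μ := by rw [le_div_iff₀ hμ]; linarith
    nlinarith
  have hC : 1 + 80 * (K ^ 2 / σ ^ 2) * (L / μ) = 1 + 80 * X := by rw [hX]; ring
  rw [hC] at hε hδ
  rw [lt_mul_inv_iff₀ (by positivity), ← hδ] at hε
  have hs1 : (1 : ℝ) ≤ √((Fintype.card κ : ℝ) - 1) := by
    rw [Real.one_le_sqrt]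
    have : (2 : ℝ) ≤ Fintype.card κ := by exact_mod_cast hκ
    linarith
  have hδ1 : √((Fintype.card κ : ℝ) - 1) * δ ≤ σ / 2 := by
    have h1 : δ ≤ σ * (1 / (2 * √((Fintype.card κ : ℝ) - 1))) :=
      hε.le.trans (mul_le_mul_of_nonneg_left (min_le_left _ _) hσ0)
    calc _ ≤ √((Fintype.card κ : ℝ) - 1) * (σ * (1 / (2 * √((Fintype.card κ : ℝ) - 1)))) := by
          gcongr
      _ = σ / 2 := by field_simp
  have hδ2 : δ ≤ σ * (1 / 4 * √(μ / L)) :=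
    hε.le.trans (mul_le_mul_of_nonneg_left (min_le_right _ _) hσ0)
  have hδ0 : 0 ≤ δ := by rw [hδ]; positivity
  have hδσ : δ ≤ σ / 2 := (le_mul_of_one_le_left hδ0 hs1).trans hδ1
  have hεX : ε / 2 ≤ ε * X := by nlinarith
  have hXσ' : 80 * (ε * (K ^ 2 * L)) = 80 * (ε * X) * (μ * σ ^ 2) := by rw [← hXσ]; ring
  refine ⟨hf, hL.le, hh, he, hnoise, hσ, hσB, hKB, hε0, by linarith, by linarith, ?_, ?_, hδ1, ?_⟩
  · have h1 : 80 * (ε * X) ≤ K / 2 := by linarith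
    have h2 : 80 * (ε * X) ≤ σ / 2 := by linarith
    have h3 : 80 * (ε * (K ^ 2 * L)) ≤ K / 2 * (μ * σ ^ 2) := by rw [hXσ']; gcongr
    refine le_of_mul_le_mul_right (a := K) ?_ hK
    linarith
  · have h1 : δ - ε = 80 * (ε * X) := by rw [hδ]; ring
    rw [h1]
    linarith
  · calc L * δ ^ 2 ≤ L * (σ * (1 / 4 * √(μ / L))) ^ 2 := by gcongr
      _ = L * σ ^ 2 / 16 * √(μ / L) ^ 2 := by ring
      _ = μ * σ ^ 2 / 16 := by rw [Real.sq_sqrt (by positivity)]; field_simp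

/-- The weights of the columns of `[W, T, W H']` with respect to the columns of `[W, T]`. -/
def outlierWeights {r t q : ℕ} (H' : Matrix (Fin r) (Fin q) ℝ) :
    (Fin r ⊕ Fin t) ⊕ Fin q → Fin r ⊕ Fin t → ℝ :=
  Sum.elim (fun i => Pi.single i 1) fun k => Sum.elim (fun i => H' i k) 0

variable {m r t q : ℕ} {H' : Matrix (Fin r) (Fin q) ℝ}

lemma outlierWeights_mem_simplex (hH : ∀ j, (fun i => H' i j) ∈ simplex (Fin r))
    (k : (Fin r ⊕ Fin t) ⊕ Fin q) : outlierWeights (t := t) H' k ∈ simplex (Fin r ⊕ Fin t) := by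
  rcases k with i | k
  · refine ⟨fun j => ?_, ?_⟩
    · simp only [outlierWeights, Sum.elim_inl, Pi.single_apply]
      split_ifs <;> norm_num
    · simp [outlierWeights]
  · refine ⟨?_, by simpa [outlierWeights] using (hH k).2⟩
    rintro (i | j)
    · exact (hH k).1 i
    · exact le_rfl

lemma sum_outlierWeights_smul (W : Matrix (Fin m) (Fin r) ℝ) (T : Matrix (Fin m) (Fin t) ℝ)
    (k : (Fin r ⊕ Fin t) ⊕ Fin q) :
    ∑ i, outlierWeights H' k i • colVec (Matrix.fromCols W T) i =
      colVec (Matrix.fromCols (Matrix.fromCols W T) (W * H')) k := by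
  rcases k with i | k
  · simp [outlierWeights, Pi.single_apply, colVec]
  · ext l
    simp [outlierWeights, colVec, Matrix.mul_apply, mul_comm]

lemma sum_outlierWeights_inl (hH : ∀ j, (fun i => H' i j) ∈ simplex (Fin r)) (i : Fin r) :
    ∑ k, outlierWeights (t := t) H' k (Sum.inl i) = 1 + rowNormOne H' i := by
  have : rowNormOne H' i = ∑ k, H' i k := Finset.sum_congr rfl fun k _ => abs_of_nonneg ((hH k).1 i)
  rw [this, Fintype.sum_sum_type]
  simp [outlierWeights, Pi.single_apply]

lemma sum_outlierWeights_inr (j : Fin t) :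
    ∑ k, outlierWeights (t := t) H' k (Sum.inr j) = 1 := by
  simp [outlierWeights, Pi.single_apply]

lemma exists_equiv_image {κ ι : Type*} [Fintype κ] [DecidableEq ι] {τ : κ → ι}
    (hinj : Function.Injective τ) :
    ∃ u : κ ≃ {i // i ∈ Finset.univ.image τ}, ∀ i, (u i).1 = τ i :=
  ⟨Equiv.ofBijective (fun i => ⟨τ i, Finset.mem_image_of_mem τ (Finset.mem_univ i)⟩)
    ⟨fun _ _ hij => hinj (congrArg Subtype.val hij), by
      rintro ⟨_, hj⟩
      obtain ⟨i, -, rfl⟩ := Finset.mem_image.1 hj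
      exact ⟨i, rfl⟩⟩, fun _ => rfl⟩

/-- When the scores separate the columns of `W` from the outliers, the unique output of the last
step consists of the extracted columns that are matched with the columns of `W`. -/
lemma isTopRows_iff_eq_image {ι : Type*} [Fintype ι] [DecidableEq ι] {r t : ℕ}
    {τ : Fin r ⊕ Fin t → ι} (hinj : Function.Injective τ) {J : Finset ι}
    (u : Fin r ⊕ Fin t ≃ {i // i ∈ J}) (hu : ∀ i, (u i).1 = τ i) {G : Matrix {i // i ∈ J} ι ℝ}
    (hsep : ∀ i j, rowNormOne G (u (Sum.inr j)) < rowNormOne G (u (Sum.inl i))) {J' : Finset ι} :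
    IsTopRows r J G J' ↔ J' = Finset.univ.image (τ ∘ Sum.inl) := by
  have hcard : (Finset.univ.image (τ ∘ Sum.inl)).card = r := by
    rw [Finset.card_image_of_injective _ (hinj.comp Sum.inl_injective), Finset.card_univ,
      Fintype.card_fin]
  have h := isTopRows_iff_of_separated (J := J) (A := Finset.univ.image (τ ∘ Sum.inl)) (J' := J')
    (G := G) (fun x hx => by
      obtain ⟨i, -, rfl⟩ := Finset.mem_image.1 hx
      rw [Function.comp_apply, ← hu]
      exact (u (Sum.inl i)).2) fun a b ha hb => by
      obtain ⟨i, hi⟩ := u.surjective a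
      obtain ⟨j, hj⟩ := u.surjective b
      subst hi hj
      rw [hu] at ha hb
      obtain ⟨i', -, hi'⟩ := Finset.mem_image.1 ha
      obtain rfl := hinj hi'
      rcases j with j | j
      · exact absurd (Finset.mem_image_of_mem (τ ∘ Sum.inl) (Finset.mem_univ j)) hb
      · exact hsep i' j
  rwa [hcard] at h

end Outliers

end SeparableNMF

theorem theorem4 (m n r t q : ℕ) (hr : 2 ≤ r) (hn : n = r + t + q)
    (W : Matrix (Fin m) (Fin r) ℝ) (T : Matrix (Fin m) (Fin t) ℝ)
    (H' : Matrix (Fin r) (Fin q) ℝ)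
    (hWH : SeparableNMF.IsSeparable W H')
    (B : Matrix (Fin m) (Fin r ⊕ Fin t) ℝ) (hB : B = Matrix.fromCols W T)
    (s : ℕ) (hs : s = r + t) (hrank : B.rank = s)
    (N M' : Matrix (Fin m) ((Fin r ⊕ Fin t) ⊕ Fin q) ℝ)
    (hM' : M' = Matrix.fromCols (Matrix.fromCols W T) (W * H') + N)
    (f : EuclideanSpace ℝ (Fin m) → ℝ) (μ L : ℝ) (hf : SeparableNMF.IsAdmissible f μ L)
    (ε εbar : ℝ) (hN : ∀ j, ‖SeparableNMF.colVec N j‖ ≤ ε)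
    (hε : ε < SeparableNMF.sigma s B *
      min (1 / (2 * √((s : ℝ) - 1))) (1 / 4 * √(μ / L)) *
      (1 + 80 * (SeparableNMF.maxColNorm B ^ 2 / SeparableNMF.sigma s B ^ 2) * (L / μ))⁻¹)
    (hεbar : εbar = ε *
      (1 + 80 * (SeparableNMF.maxColNorm B ^ 2 / SeparableNMF.sigma s B ^ 2) * (L / μ)))
    (hH : ∀ i, 2 * (2 * (n : ℝ) - t - r) * ((εbar + ε) / SeparableNMF.sigma s B) <
      SeparableNMF.rowNormOne H' i) :
    (∃ J' : Finset ((Fin r ⊕ Fin t) ⊕ Fin q), SeparableNMF.IsOutlierOutput f M' r t J') ∧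
    ∀ J' : Finset ((Fin r ⊕ Fin t) ⊕ Fin q), SeparableNMF.IsOutlierOutput f M' r t J' →
      ∃ P : {j // j ∈ J'} ≃ Fin r,
        ∀ j : {j // j ∈ J'},
          ‖SeparableNMF.colVec M' j.1 - SeparableNMF.colVec W (P j)‖ ≤ εbar := by
  open SeparableNMF in
  have hcard : Fintype.card (Fin r ⊕ Fin t) = s := by simp [hs]
  subst hB
  rw [← hcard] at hε hεbar hH
  have F := noisyFactorization_of_lt (M := M') (e := Sum.inl) hf (by omega)
    (outlierWeights_mem_simplex hWH.col_mem) (fun i => rfl) (fun k => by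
      rw [sum_outlierWeights_smul, hM']
      refine le_of_eq_of_le (congrArg norm ?_) (hN k)
      ext l
      simp [colVec]) hε hεbar
  have hrt : r + t = Fintype.card (Fin r ⊕ Fin t) := by simp
  -- The bound on the scores puts every row of `G` that belongs to `W` above every row that belongs
  -- to an outlier.
  have hout : ∀ J, IsRecursiveOutput f M' (r + t) J → ∃ τ : Fin r ⊕ Fin t → _,
      Function.Injective τ ∧ (∀ i, ‖colVec M' (τ i) - colVec (Matrix.fromCols W T) i‖ ≤ εbar) ∧
      ∀ G, IsAbundance M' J G → ∀ J', IsTopRows r J G J' ↔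
        J' = Finset.univ.image (τ ∘ Sum.inl) := by
    intro J hJ
    rw [hrt] at hJ
    obtain ⟨τ, hinj, rfl, hτ⟩ := F.exists_injective_of_isRecursiveOutput hJ
    refine ⟨τ, hinj, hτ, fun G hG J' => ?_⟩
    obtain ⟨u, hu⟩ := exists_equiv_image hinj
    refine isTopRows_iff_eq_image hinj u hu fun i j => ?_
    have h1 := abs_le.1 (F.abs_rowNormOne_sub_le hτ u hu hG (Sum.inl i))
    have h2 := abs_le.1 (F.abs_rowNormOne_sub_le hτ u hu hG (Sum.inr j))
    rw [sum_outlierWeights_inl hWH.col_mem] at h1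
    rw [sum_outlierWeights_inr] at h2
    have h3 := hH i
    have h4 : (2 * (n : ℝ) - t - r) = 2 * Fintype.card ((Fin r ⊕ Fin t) ⊕ Fin q) -
        Fintype.card (Fin r ⊕ Fin t) := by
      rw [hn]; simp only [Fintype.card_sum, Fintype.card_fin]; push_cast; ring
    rw [h4] at h3
    linarith [h1.1, h2.2]
  refine ⟨?_, ?_⟩
  · obtain ⟨J, hJ⟩ := F.exists_isRecursiveOutput
    rw [← hrt] at hJ
    obtain ⟨τ, -, -, htop⟩ := hout J hJ
    obtain ⟨G, hG⟩ := exists_isAbundance M' J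
    exact ⟨_, J, G, hJ, hG, (htop G hG _).2 rfl⟩
  · rintro J' ⟨J, G, hJ, hG, hJ'⟩
    obtain ⟨τ, hinj, hτ, htop⟩ := hout J hJ
    obtain rfl := (htop G hG J').1 hJ'
    obtain ⟨v, hv⟩ := exists_equiv_image (hinj.comp Sum.inl_injective)
    refine ⟨v.symm, fun j => ?_⟩
    obtain ⟨i, rfl⟩ := v.surjective j
    rw [v.symm_apply_apply, hv]
    exact hτ (Sum.inl i)
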